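/- Let $\Omega\subset\mathbb R^m$ be a bounded domain (a bounded nonempty connected open set), let $H\in L^\infty(\Omega)$, and let $\vec F=(F_1,\dots,F_m)\in L^1(\Omega;\mathbb R^m)$ be a weakly differentiable vector field (each $F_I$ has first order weak partial derivatives in $L^1_{\mathrm{loc}}(\Omega)$). For $w\in W^{1,1}(\Omega)$ set $$\mathcal F_H(w)=\int_\Omega\bigl(|\nabla w+\vec F|+Hw\bigr)\,dx,$$ and call $w\in W^{1,1}(\Omega)$ a minimizer of $\mathcal F_H$ in $W^{1,1}(\Omega)$ if $\mathcal F_H(w)\le\mathcal F_H(w+\varphi)$ for all $\varphi\in W^{1,1}_0(\Omega)$. For $w\in W^{2,1}(\Omega)$ let $\Theta_w=dw+\sum_I F_I\,dx^I=\sum_I(\partial_Iw+F_I)\,dx^I$, with weak exterior derivative $d\Theta_w$, and call $\Theta_w$ nonintegrable if $\Theta_w\wedge d\Theta_w\neq0$ a.e. in $\Omega$. Here $W^{k,1}_0(\Omega)$ denotes the closure of $C_c^\infty(\Omega)$ in $W^{k,1}(\Omega)$. Let $u,v\in W^{2,1}(\Omega)$ be two minimizers of $\mathcal F_H$ in $W^{1,1}(\Omega)$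 with $u-v\in W^{2,1}_0(\Omega)$. Suppose that for some constant $C>0$ one has $|\nabla u+\vec F|\ge C$ and $|\nabla v+\vec F|\ge C$ a.e. in $\Omega$, and that $\Theta_u$ is nonintegrable or $\Theta_v$ is nonintegrable. Then $u=v$ a.e. in $\Omega$. -/

import Mathlib

open MeasureTheory
open scoped ContDiff ENNReal

/-- Test functions on `Ω`: smooth real functions with compact support contained in `Ω`. -/
def IsTestFunction {m : ℕ} (Ω : Set (EuclideanSpace ℝ (Fin m)))
    (φ : EuclideanSpace ℝ (Fin m) → ℝ) : Prop :=
  ContDiff ℝ ∞ φ ∧ HasCompactSupport φ ∧ tsupport φ ⊆ Ω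

/-- `g` is a weak partial derivative `∂u/∂xᵢ` of `u` on `Ω`: both functions are locally integrable
on `Ω` and `∫ u ∂ᵢφ = - ∫ g φ` for all test functions `φ` on `Ω`. -/
def IsWeakPartial {m : ℕ} (Ω : Set (EuclideanSpace ℝ (Fin m))) (i : Fin m)
    (u g : EuclideanSpace ℝ (Fin m) → ℝ) : Prop :=
  LocallyIntegrableOn u Ω ∧ LocallyIntegrableOn g Ω ∧
    ∀ φ, IsTestFunction Ω φ →
      ∫ x in Ω, u x * fderiv ℝ φ x (EuclideanSpace.single i 1) = - ∫ x in Ω, g x * φ x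

/-- The space `W¹(Ω)` of weakly differentiable functions: locally integrable functions all of whose
first order weak partial derivatives exist (as locally integrable functions). -/
def WeaklyDifferentiable {m : ℕ} (Ω : Set (EuclideanSpace ℝ (Fin m)))
    (u : EuclideanSpace ℝ (Fin m) → ℝ) : Prop :=
  LocallyIntegrableOn u Ω ∧ ∀ i, ∃ g, IsWeakPartial Ω i u g

open Classical in
/-- A chosen representative of the weak partial derivative `∂u/∂xᵢ` on the open set `Ω` (unique up
to null sets in `Ω`); by convention it is `0` if there is no weak partial derivative. -/
noncomputable def weakPartial {m : ℕ} (Ω : Set (EuclideanSpace ℝ (Fin m))) (i : Fin m)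
    (u : EuclideanSpace ℝ (Fin m) → ℝ) : EuclideanSpace ℝ (Fin m) → ℝ :=
  if h : ∃ g, IsWeakPartial Ω i u g then h.choose else 0

/-- The weak gradient `∇u`. -/
noncomputable def weakGrad {m : ℕ} (Ω : Set (EuclideanSpace ℝ (Fin m)))
    (u : EuclideanSpace ℝ (Fin m) → ℝ) (x : EuclideanSpace ℝ (Fin m)) :
    EuclideanSpace ℝ (Fin m) :=
  WithLp.toLp 2 fun i => weakPartial Ω i u x

/-- The Sobolev space `W^{k,1}(Ω)`: `u` is integrable on `Ω`, and so are all its weak partial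
derivatives up to order `k`. -/
def MemSobolevOne {m : ℕ} (Ω : Set (EuclideanSpace ℝ (Fin m))) :
    ℕ → (EuclideanSpace ℝ (Fin m) → ℝ) → Prop
  | 0, u => IntegrableOn u Ω
  | k + 1, u => IntegrableOn u Ω ∧ ∀ i, ∃ g, IsWeakPartial Ω i u g ∧ MemSobolevOne Ω k g

/-- The `W^{k,1}(Ω)` norm: the sum of the `L¹(Ω)` norms of the iterated weak partial derivatives
`∂_{i₁} ⋯ ∂_{iₗ} u`, `l ≤ k`. -/
noncomputable def sobolevOneNorm {m : ℕ} (Ω : Set (EuclideanSpace ℝ (Fin m))) :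
    ℕ → (EuclideanSpace ℝ (Fin m) → ℝ) → ℝ≥0∞
  | 0, u => ∫⁻ x in Ω, ‖u x‖ₑ
  | k + 1, u => (∫⁻ x in Ω, ‖u x‖ₑ) + ∑ i, sobolevOneNorm Ω k (weakPartial Ω i u)

/-- The space `W₀^{k,1}(Ω)`: the closure of the test functions in `W^{k,1}(Ω)`. -/
def MemSobolevOneZero {m : ℕ} (Ω : Set (EuclideanSpace ℝ (Fin m))) (k : ℕ)
    (u : EuclideanSpace ℝ (Fin m) → ℝ) : Prop :=
  MemSobolevOne Ω k u ∧
    ∀ ε : ℝ≥0∞, 0 < ε → ∃ φ, IsTestFunction Ω φ ∧ sobolevOneNorm Ω k (u - φ) < ε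

/-- The generalized `p`-area `𝓕_H(u) = ∫_Ω (|∇u + F| + H u)`. -/
noncomputable def genPArea {m : ℕ} (Ω : Set (EuclideanSpace ℝ (Fin m)))
    (F : EuclideanSpace ℝ (Fin m) → EuclideanSpace ℝ (Fin m))
    (H : EuclideanSpace ℝ (Fin m) → ℝ) (u : EuclideanSpace ℝ (Fin m) → ℝ) : ℝ :=
  ∫ x in Ω, (‖weakGrad Ω u x + F x‖ + H x * u x)

/-- `u` is a minimizer of `𝓕_H` in `W^{1,1}(Ω)`. -/
def IsGenPAreaMinimizer {m : ℕ} (Ω : Set (EuclideanSpace ℝ (Fin m)))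
    (F : EuclideanSpace ℝ (Fin m) → EuclideanSpace ℝ (Fin m))
    (H : EuclideanSpace ℝ (Fin m) → ℝ) (u : EuclideanSpace ℝ (Fin m) → ℝ) : Prop :=
  MemSobolevOne Ω 1 u ∧
    ∀ φ, MemSobolevOneZero Ω 1 φ → genPArea Ω F H u ≤ genPArea Ω F H (u + φ)

/-- The coefficients of the 1-form `Θ_w = dw + F_I dx^I = (∂_I w + F_I) dx^I`. -/
noncomputable def thetaForm {m : ℕ} (Ω : Set (EuclideanSpace ℝ (Fin m)))
    (F : EuclideanSpace ℝ (Fin m) → EuclideanSpace ℝ (Fin m))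
    (w : EuclideanSpace ℝ (Fin m) → ℝ) (I : Fin m) : EuclideanSpace ℝ (Fin m) → ℝ :=
  fun x => weakPartial Ω I w x + F x I

/-- The coefficients `(dα)_{IJ} = ∂_I α_J - ∂_J α_I` of the weak exterior derivative
`dα = ∑_{I<J} (dα)_{IJ} dx^I ∧ dx^J` of the 1-form `α = α_I dx^I`. -/
noncomputable def weakExtDerivOne {m : ℕ} (Ω : Set (EuclideanSpace ℝ (Fin m)))
    (α : Fin m → EuclideanSpace ℝ (Fin m) → ℝ) (I J : Fin m) : EuclideanSpace ℝ (Fin m) → ℝ :=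
  fun x => weakPartial Ω I (α J) x - weakPartial Ω J (α I) x

/-- The coefficients of the 3-form `α ∧ β = ∑_{I<J<K} (α ∧ β)_{IJK} dx^I ∧ dx^J ∧ dx^K`, for a
1-form `α = α_I dx^I` and a 2-form `β = ∑_{I<J} β_{IJ} dx^I ∧ dx^J` with skew-symmetric `β_{IJ}`. -/
def wedgeOneTwo {m : ℕ} (α : Fin m → ℝ) (β : Fin m → Fin m → ℝ) (I J K : Fin m) : ℝ :=
  α I * β J K + α J * β K I + α K * β I J

/-- `Θ_w` is nonintegrable on `Ω`: the 3-form `Θ_w ∧ dΘ_w` is nonzero at almost every point. -/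
def ThetaNonintegrable {m : ℕ} (Ω : Set (EuclideanSpace ℝ (Fin m)))
    (F : EuclideanSpace ℝ (Fin m) → EuclideanSpace ℝ (Fin m))
    (w : EuclideanSpace ℝ (Fin m) → ℝ) : Prop :=
  ∀ᵐ x ∂(volume.restrict Ω), ∃ I J K,
    wedgeOneTwo (fun A => thetaForm Ω F w A x)
      (fun A B => weakExtDerivOne Ω (thetaForm Ω F w) A B x) I J K ≠ 0

/-! ### Products and derivatives of test functions. -/

section TestFunctions

variable {m : ℕ} {Ω : Set (EuclideanSpace ℝ (Fin m))} {φ ψ f : EuclideanSpace ℝ (Fin m) → ℝ}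

/-! The midpoint of `u` and `v` is an admissible competitor for both minimizers. The `H`-term is
affine, so equality must hold a.e. in the triangle inequality for `∇u + F` and `∇v + F`: the two
fields lie on a common ray (`IsGenPAreaMinimizer.sameRay`).

Hence `η = d(u - v) = Θ_u - Θ_v` is parallel to `α = Θ_u` (say `Θ_u` is nonintegrable), that is, `η
∧ α = 0`. Since `dη = 0`, differentiating gives `η ∧ dα = 0`
(`wedgeOneTwo_weakExtDerivOne_ae_eq_zero`). Parallelism and `α ∧ dα ≠ 0` then force `η = 0` by
pointwise linear algebra (`eq_zero_of_wedgeOneTwo`). Finally `u - v` lies in `W₀^{1,1}` and has zero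
gradient, so it vanishes (`MemSobolevOneZero.ae_eq_zero`).

The delicate point is differentiating `η ∧ α = 0`: the coefficients and their derivatives are only
locally integrable, so the terms of the product rule need not be. Each 2×2 minor is a polynomial `Q`
of four weakly differentiable functions. Multiplying `Q` by a compactly supported cutoff gives a
function for which the weak chain rule holds (`IsWeakDerivAlong.comp`, by mollification). The
composition vanishes a.e., hence so does its derivative, and letting the cutoff exhaust the space
yields the pointwise Leibniz identity. -/

theorem IsTestFunction.fderiv_apply (hφ : IsTestFunction Ω φ) (v : EuclideanSpace ℝ (Fin m)) :
    IsTestFunction Ω (fun x => fderiv ℝ φ x v) := by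
  have hs : tsupport (fun x => fderiv ℝ φ x v) ⊆ tsupport φ := tsupport_fderiv_apply_subset ℝ v
  refine ⟨?_, hφ.2.1.fderiv_apply ℝ v, hs.trans hφ.2.2⟩
  exact (hφ.1.fderiv_right (m := ∞) (by simp)).clm_apply contDiff_const

theorem IsTestFunction.mul (hφ : IsTestFunction Ω φ) (hψ : ContDiff ℝ ∞ ψ) :
    IsTestFunction Ω (fun x => φ x * ψ x) :=
  ⟨hφ.1.mul hψ, hφ.2.1.mul_right, (tsupport_mul_subset_left (f := φ) (g := ψ)).trans hφ.2.2⟩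

theorem IsTestFunction.const_mul (hφ : IsTestFunction Ω φ) (c : ℝ) :
    IsTestFunction Ω (fun x => c * φ x) := by
  simpa only [mul_comm c] using hφ.mul (contDiff_const (c := c))

theorem IsTestFunction.eq_zero_of_notMem (hφ : IsTestFunction Ω φ)
    {x : EuclideanSpace ℝ (Fin m)} (hx : x ∉ Ω) : φ x = 0 :=
  image_eq_zero_of_notMem_tsupport fun h => hx (hφ.2.2 h)

theorem IsTestFunction.integrable_mul (hφ : IsTestFunction Ω φ) (hf : LocallyIntegrableOn f Ω) :
    Integrable (fun x => f x * φ x) := by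
  have h1 : IntegrableOn f (tsupport φ) := hf.integrableOn_compact_subset hφ.2.2 hφ.2.1
  rw [← integrableOn_iff_integrable_of_support_subset (s := tsupport φ)]
  · exact h1.mul_continuousOn hφ.1.continuous.continuousOn hφ.2.1
  · exact (Function.support_mul_subset_right f φ).trans (subset_tsupport φ)

theorem IsTestFunction.setIntegral_mul (hφ : IsTestFunction Ω φ) :
    ∫ x in Ω, f x * φ x = ∫ x, f x * φ x :=
  setIntegral_eq_integral_of_forall_compl_eq_zero fun x hx => by
    simp [hφ.eq_zero_of_notMem hx]

end TestFunctions

/-! ### Calculus of weak partial derivatives on an open set. -/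

section WeakPartial

variable {m : ℕ} {Ω : Set (EuclideanSpace ℝ (Fin m))} {i j : Fin m}
  {u v g h : EuclideanSpace ℝ (Fin m) → ℝ}

theorem IsWeakPartial.integral_eq (H : IsWeakPartial Ω i u g)
    {φ : EuclideanSpace ℝ (Fin m) → ℝ} (hφ : IsTestFunction Ω φ) :
    ∫ x, u x * fderiv ℝ φ x (EuclideanSpace.single i 1) = - ∫ x, g x * φ x := by
  rw [← hφ.setIntegral_mul, ← (hφ.fderiv_apply _).setIntegral_mul]
  exact H.2.2 φ hφ

theorem ae_restrict_eq_zero_of_forall_test (hΩ : IsOpen Ω) (hu : LocallyIntegrableOn u Ω)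
    (H : ∀ φ, IsTestFunction Ω φ → ∫ x in Ω, u x * φ x = 0) :
    u =ᵐ[volume.restrict Ω] 0 := by
  rw [Filter.EventuallyEq, ae_restrict_iff' hΩ.measurableSet]
  refine hΩ.ae_eq_zero_of_integral_contDiff_smul_eq_zero hu fun φ h1 h2 h3 => ?_
  have hφ : IsTestFunction Ω φ := ⟨h1, h2, h3⟩
  simpa [mul_comm, hφ.setIntegral_mul (f := u)] using H φ hφ

theorem IsWeakPartial.ae_unique (hΩ : IsOpen Ω) (hg : IsWeakPartial Ω i u g)
    (hh : IsWeakPartial Ω i u h) : g =ᵐ[volume.restrict Ω] h := by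
  have := ae_restrict_eq_zero_of_forall_test hΩ (hg.2.1.sub hh.2.1) fun φ hφ => by
    have e : ∀ x, (g - h) x * φ x = g x * φ x - h x * φ x := fun x => by simp [sub_mul]
    rw [hφ.setIntegral_mul]
    simp only [e]
    rw [integral_sub (hφ.integrable_mul hg.2.1) (hφ.integrable_mul hh.2.1), sub_eq_zero,
      ← neg_inj, ← hg.integral_eq hφ, ← hh.integral_eq hφ]
  filter_upwards [this] with x hx
  simpa [sub_eq_zero] using hx

theorem IsWeakPartial.congr (hg : IsWeakPartial Ω i u g) (huv : u =ᵐ[volume.restrict Ω] v)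
    (hgh : g =ᵐ[volume.restrict Ω] h) : IsWeakPartial Ω i v h := by
  refine ⟨hg.1.congr huv, hg.2.1.congr hgh, fun φ hφ => ?_⟩
  have e1 : ∫ x in Ω, u x * fderiv ℝ φ x (EuclideanSpace.single i 1) =
      ∫ x in Ω, v x * fderiv ℝ φ x (EuclideanSpace.single i 1) :=
    integral_congr_ae (by filter_upwards [huv] with x hx; rw [hx])
  have e2 : ∫ x in Ω, g x * φ x = ∫ x in Ω, h x * φ x :=
    integral_congr_ae (by filter_upwards [hgh] with x hx; rw [hx])
  rw [← e1, ← e2]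
  exact hg.2.2 φ hφ

theorem IsWeakPartial.isWeakPartial_weakPartial (hg : IsWeakPartial Ω i u g) :
    IsWeakPartial Ω i u (weakPartial Ω i u) := by
  have : ∃ g, IsWeakPartial Ω i u g := ⟨g, hg⟩
  rw [weakPartial, dif_pos this]
  exact this.choose_spec

theorem IsWeakPartial.weakPartial_ae_eq (hΩ : IsOpen Ω) (hg : IsWeakPartial Ω i u g) :
    weakPartial Ω i u =ᵐ[volume.restrict Ω] g :=
  hg.isWeakPartial_weakPartial.ae_unique hΩ hg

theorem IsWeakPartial.add (hg : IsWeakPartial Ω i u g) (hh : IsWeakPartial Ω i v h) :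
    IsWeakPartial Ω i (u + v) (g + h) := by
  refine ⟨hg.1.add hh.1, hg.2.1.add hh.2.1, fun φ hφ => ?_⟩
  rw [hφ.setIntegral_mul, (hφ.fderiv_apply _).setIntegral_mul]
  simp only [Pi.add_apply, add_mul]
  rw [integral_add ((hφ.fderiv_apply _).integrable_mul hg.1)
    ((hφ.fderiv_apply _).integrable_mul hh.1),
    integral_add (hφ.integrable_mul hg.2.1) (hφ.integrable_mul hh.2.1),
    hg.integral_eq hφ, hh.integral_eq hφ, neg_add]

theorem IsWeakPartial.const_smul (hg : IsWeakPartial Ω i u g) (c : ℝ) :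
    IsWeakPartial Ω i (c • u) (c • g) := by
  refine ⟨hg.1.smul c, hg.2.1.smul c, fun φ hφ => ?_⟩
  simp only [Pi.smul_apply, smul_eq_mul, mul_assoc, integral_const_mul, hg.2.2 φ hφ, mul_neg]

theorem IsWeakPartial.sub (hg : IsWeakPartial Ω i u g) (hh : IsWeakPartial Ω i v h) :
    IsWeakPartial Ω i (u - v) (g - h) := by
  simpa [sub_eq_add_neg] using hg.add (hh.const_smul (-1))

theorem ContDiff.isWeakPartial (hu : ContDiff ℝ ∞ u) :
    IsWeakPartial Ω i u (fun x => fderiv ℝ u x (EuclideanSpace.single i 1)) := by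
  have hc : Continuous fun x => fderiv ℝ u x (EuclideanSpace.single i (1 : ℝ)) :=
    (hu.continuous_fderiv (by simp)).clm_apply continuous_const
  have h1 := hu.continuous.locallyIntegrable (μ := volume).locallyIntegrableOn Ω
  have h2 := hc.locallyIntegrable (μ := volume).locallyIntegrableOn Ω
  refine ⟨h1, h2, fun φ hφ => ?_⟩
  rw [hφ.setIntegral_mul, (hφ.fderiv_apply _).setIntegral_mul]
  exact integral_mul_fderiv_eq_neg_fderiv_mul_of_integrable (hφ.integrable_mul h2)
    ((hφ.fderiv_apply _).integrable_mul h1) (hφ.integrable_mul h1)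
    (fun x _ => hu.differentiable (by simp) x) (fun x _ => hφ.1.differentiable (by simp) x)

/-- Weak second derivatives commute. -/
theorem IsWeakPartial.second_comm (hΩ : IsOpen Ω) {gi gj gij gji : EuclideanSpace ℝ (Fin m) → ℝ}
    (hi : IsWeakPartial Ω i u gi) (hj : IsWeakPartial Ω j u gj)
    (hij : IsWeakPartial Ω i gj gij) (hji : IsWeakPartial Ω j gi gji) :
    gij =ᵐ[volume.restrict Ω] gji := by
  -- It suffices that `gji` is also a weak `i`-th derivative of `gj`; both derivatives are moved
  -- onto `φ`, where they commute.
  refine hij.ae_unique hΩ ⟨hj.2.1, hji.2.1, fun φ hφ => ?_⟩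
  rw [hφ.setIntegral_mul, (hφ.fderiv_apply _).setIntegral_mul, ← hji.integral_eq hφ,
    ← neg_inj, ← hj.integral_eq (hφ.fderiv_apply _), ← hi.integral_eq (hφ.fderiv_apply _)]
  congr 1 with x
  congr 1
  have hd : DifferentiableAt ℝ (fderiv ℝ φ) x :=
    (hφ.1.fderiv_right (m := ∞) (by simp)).differentiable (by simp) x
  rw [fderiv_clm_apply hd (by fun_prop), fderiv_clm_apply hd (by fun_prop)]
  simp only [fderiv_fun_const, Pi.zero_apply, ContinuousLinearMap.comp_zero, zero_add,
    ContinuousLinearMap.flip_apply]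
  exact (hφ.1.contDiffAt.isSymmSndFDerivAt (by simpa using ENat.LEInfty.out)).eq _ _

end WeakPartial

/-! ### Mollification and the chain rule for vector-valued weak derivatives. -/

section Mollification

open Filter Topology ContinuousLinearMap
open scoped Convolution

/-- Scheffé's lemma, with varying dominating functions. -/
theorem MeasureTheory.tendsto_integral_norm_sub_of_dominated_of_integral_eq {α V : Type*}
    [MeasurableSpace α] {μ : Measure α} [NormedAddCommGroup V] {F : ℕ → α → V} {f : α → V}
    {k : ℕ → α → ℝ} (hF : ∀ n, Integrable (F n) μ) (hf : Integrable f μ)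
    (hk : ∀ n, Integrable (k n) μ) (hFk : ∀ n, ∀ᵐ x ∂μ, ‖F n x‖ ≤ k n x)
    (hFf : ∀ᵐ x ∂μ, Tendsto (fun n => F n x) atTop (𝓝 (f x)))
    (hkf : ∀ᵐ x ∂μ, Tendsto (fun n => k n x) atTop (𝓝 ‖f x‖))
    (hint : ∀ n, ∫ x, k n x ∂μ = ∫ x, ‖f x‖ ∂μ) :
    Tendsto (fun n => ∫ x, ‖F n x - f x‖ ∂μ) atTop (𝓝 0) := by
  -- With `k = k n`, `‖F n - f‖ ≤ min ‖F n - f‖ (2‖f‖) + (‖f‖ - k)⁺ + (k - ‖f‖)`. The first two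
  -- terms tend to zero by dominated convergence, with bounds `2‖f‖` and `‖f‖`; the last has
  -- integral zero.
  have hA : ∀ n, Integrable (fun x => min ‖F n x - f x‖ (2 * ‖f x‖)) μ := fun n =>
    ((hF n).sub hf).norm.inf (hf.norm.const_mul 2)
  have hB : ∀ n, Integrable (fun x => max (‖f x‖ - k n x) 0) μ := fun n =>
    (hf.norm.sub (hk n)).pos_part
  have tA : Tendsto (fun n => ∫ x, min ‖F n x - f x‖ (2 * ‖f x‖) ∂μ) atTop (𝓝 0) := by
    rw [← integral_zero α ℝ (μ := μ)]
    refine tendsto_integral_of_dominated_convergence (fun x => 2 * ‖f x‖)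
      (fun n => (hA n).aestronglyMeasurable) (hf.norm.const_mul 2) (fun n => ?_) ?_
    · refine Eventually.of_forall fun x => ?_
      rw [Real.norm_of_nonneg (by positivity)]
      exact min_le_right _ _
    · filter_upwards [hFf] with x hx
      have h1 : Tendsto (fun n => ‖F n x - f x‖) atTop (𝓝 0) :=
        tendsto_iff_norm_sub_tendsto_zero.1 hx
      exact squeeze_zero (fun n => by positivity) (fun n => min_le_left _ _) h1
  have tB : Tendsto (fun n => ∫ x, max (‖f x‖ - k n x) 0 ∂μ) atTop (𝓝 0) := by
    rw [show 𝓝 (0 : ℝ) = 𝓝 (∫ _, (0 : ℝ) ∂μ) by simp]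
    refine tendsto_integral_of_dominated_convergence (fun x => ‖f x‖)
      (fun n => (hB n).aestronglyMeasurable) hf.norm (fun n => ?_) ?_
    · filter_upwards [hFk n] with x hx
      rw [Real.norm_of_nonneg (le_max_right _ _)]
      have := norm_nonneg (F n x)
      exact max_le (by linarith) (norm_nonneg _)
    · filter_upwards [hkf] with x hx
      have := (hx.const_sub ‖f x‖).max (tendsto_const_nhds (x := (0 : ℝ)))
      simpa using this
  refine squeeze_zero (fun n => integral_nonneg fun x => norm_nonneg _) (fun n => ?_)
    (by simpa using tA.add tB)
  have e : ∫ x, (k n x - ‖f x‖) ∂μ = 0 := by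
    rw [integral_sub (hk n) hf.norm, hint n, sub_self]
  calc ∫ x, ‖F n x - f x‖ ∂μ
      ≤ ∫ x, (min ‖F n x - f x‖ (2 * ‖f x‖) + max (‖f x‖ - k n x) 0 + (k n x - ‖f x‖)) ∂μ := by
        refine integral_mono_ae ((hF n).sub hf).norm (((hA n).add (hB n)).add
          ((hk n).sub hf.norm)) ?_
        filter_upwards [hFk n] with x hx
        have h1 := norm_sub_le (F n x) (f x)
        change ‖F n x - f x‖ ≤ min _ _ + max _ _ + (k n x - ‖f x‖)
        rcases min_cases ‖F n x - f x‖ (2 * ‖f x‖) with ⟨h, _⟩ | ⟨h, _⟩ <;>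
          rcases max_cases (‖f x‖ - k n x) 0 with ⟨h', _⟩ | ⟨h', _⟩ <;> linarith
    _ = _ := by
        have e1 := integral_add ((hA n).add (hB n)) ((hk n).sub hf.norm)
        simp only [Pi.add_apply, Pi.sub_apply] at e1
        rw [e1, e, integral_add (hA n) (hB n), add_zero]

/-- A sequence of bump functions with shrinking supports. -/
noncomputable def bumpSeq (E : Type*) [NormedAddCommGroup E] (n : ℕ) : ContDiffBump (0 : E) where
  rIn := 1 / (n + 1) / 2
  rOut := 1 / (n + 1)
  rIn_pos := by positivity
  rIn_lt_rOut := half_lt_self (by positivity)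

theorem tendsto_bumpSeq_rOut {E : Type*} [NormedAddCommGroup E] : Tendsto (fun n => (bumpSeq E n).rOut) atTop (𝓝 0) :=
  tendsto_one_div_add_atTop_nhds_zero_nat

variable {E V : Type*} [NormedAddCommGroup E] [NormedSpace ℝ E] [FiniteDimensional ℝ E]
  [MeasurableSpace E] [BorelSpace E] {μ : Measure E} [μ.IsAddHaarMeasure]
  [NormedAddCommGroup V] [NormedSpace ℝ V]

theorem ae_tendsto_bumpSeq_convolution [CompleteSpace V] {f : E → V} (hf : Integrable f μ) :
    ∀ᵐ x ∂μ, Tendsto (fun n => ((bumpSeq E n).normed μ ⋆[lsmul ℝ ℝ, μ] f) x) atTop (𝓝 (f x)) :=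
  -- `K = 2` is the constant ratio of outer to inner radius.
  ContDiffBump.ae_convolution_tendsto_right_of_locallyIntegrable (K := 2) tendsto_bumpSeq_rOut
    (Eventually.of_forall fun n => by simp only [bumpSeq]; linarith) hf.locallyIntegrable

theorem integrable_bumpSeq_convolution {f : E → V} (hf : Integrable f μ) (n : ℕ) :
    Integrable ((bumpSeq E n).normed μ ⋆[lsmul ℝ ℝ, μ] f) μ :=
  ((bumpSeq E n).integrable_normed).integrable_convolution _ hf

/-- Scheffé's lemma applies with the mollifications of `‖f‖` as dominating functions: mollifiers
have mass one, so these all have the integral of `‖f‖`. -/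
theorem tendsto_integral_norm_bumpSeq_convolution_sub [CompleteSpace V] {f : E → V} (hf : Integrable f μ) :
    Tendsto (fun n => ∫ x, ‖((bumpSeq E n).normed μ ⋆[lsmul ℝ ℝ, μ] f) x - f x‖ ∂μ)
      atTop (𝓝 0) := by
  refine tendsto_integral_norm_sub_of_dominated_of_integral_eq
    (k := fun n => (bumpSeq E n).normed μ ⋆[lsmul ℝ ℝ, μ] fun x => ‖f x‖)
    (integrable_bumpSeq_convolution hf) hf (integrable_bumpSeq_convolution hf.norm)
    (fun n => Eventually.of_forall fun x => ?_) (ae_tendsto_bumpSeq_convolution hf)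
    (ae_tendsto_bumpSeq_convolution hf.norm) fun n => ?_
  · refine (norm_integral_le_integral_norm _).trans (le_of_eq ?_)
    refine integral_congr_ae (Eventually.of_forall fun t => ?_)
    simp [norm_smul, abs_of_nonneg ((bumpSeq E n).nonneg_normed t)]
  · rw [integral_convolution _ (bumpSeq E n).integrable_normed hf.norm]
    simp [(bumpSeq E n).integral_normed]

/-- `h` is a weak derivative of `f` in the direction `e`, on the whole space. -/
def IsWeakDerivAlong (μ : Measure E) (e : E) (f h : E → V) : Prop :=
  ∀ φ : E → ℝ, ContDiff ℝ ∞ φ → HasCompactSupport φ →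
    ∫ x, fderiv ℝ φ x e • f x ∂μ = - ∫ x, φ x • h x ∂μ

/-- The derivative falls on `ρ`, and `t ↦ ρ (x - t)` is itself a test function; the sign from the
reflection cancels the one from integration by parts. -/
theorem IsWeakDerivAlong.fderiv_convolution {e : E} {f h : E → V} (hf : Integrable f μ)
    (H : IsWeakDerivAlong μ e f h) {ρ : E → ℝ} (hρ : ContDiff ℝ ∞ ρ) (hρc : HasCompactSupport ρ)
    (x : E) : fderiv ℝ (ρ ⋆[lsmul ℝ ℝ, μ] f) x e = (ρ ⋆[lsmul ℝ ℝ, μ] h) x := by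
  have h1 := hρc.hasFDerivAt_convolution_left (lsmul ℝ ℝ : ℝ →L[ℝ] V →L[ℝ] V) (μ := μ)
    (hρ.of_le (by simp)) hf.locallyIntegrable x
  have hint : Integrable (fun t => (precompL E (lsmul ℝ ℝ : ℝ →L[ℝ] V →L[ℝ] V))
      (fderiv ℝ ρ t) (f (x - t))) μ :=
    (hρc.fderiv ℝ).convolutionExists_left _ (hρ.continuous_fderiv (by simp))
      hf.locallyIntegrable x
  have hφ : ContDiff ℝ ∞ fun t => ρ (x - t) := hρ.comp (contDiff_const.sub contDiff_id)
  have hφc : HasCompactSupport fun t => ρ (x - t) :=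
    hρc.comp_homeomorph (Homeomorph.subLeft x)
  have hd : ∀ t, fderiv ℝ (fun t => ρ (x - t)) t e = - fderiv ℝ ρ (x - t) e := fun t => by
    have h2 : HasFDerivAt (fun t => ρ (x - t)) ((fderiv ℝ ρ (x - t)).comp (-.id ℝ E)) t :=
      (hρ.differentiable (by simp) (x - t)).hasFDerivAt.comp t ((hasFDerivAt_id t).const_sub x)
    simp [h2.fderiv]
  have key := H _ hφ hφc
  simp only [hd, neg_smul, integral_neg, neg_inj] at key
  rw [h1.fderiv, convolution_def, convolution_def, ContinuousLinearMap.integral_apply hint]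
  simp only [precompL_apply, lsmul_apply]
  rw [← integral_sub_left_eq_self (fun t => fderiv ℝ ρ t e • f (x - t)) μ x,
    ← integral_sub_left_eq_self (fun t => ρ t • h (x - t)) μ x]
  simpa using key

theorem ContDiff.bumpSeq_convolution {f : E → V} (hf : Integrable f μ) (n : ℕ) :
    ContDiff ℝ ∞ ((bumpSeq E n).normed μ ⋆[lsmul ℝ ℝ, μ] f) :=
  (bumpSeq E n).hasCompactSupport_normed.contDiff_convolution_left _
    (bumpSeq E n).contDiff_normed hf.locallyIntegrable

/-- Chain rule for the composition of a weakly differentiable vector valued function with a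
compactly supported smooth function. -/
theorem IsWeakDerivAlong.comp [CompleteSpace V] {e : E} {f h : E → V} (H : IsWeakDerivAlong μ e f h)
    (hf : Integrable f μ) (hh : Integrable h μ) {G : V → ℝ} (hG : ContDiff ℝ ∞ G)
    (hGc : HasCompactSupport G) :
    IsWeakDerivAlong μ e (fun x => G (f x)) (fun x => fderiv ℝ G (f x) (h x)) := by
  intro φ hφ hφc
  set F : ℕ → E → V := fun n => (bumpSeq E n).normed μ ⋆[lsmul ℝ ℝ, μ] f with hFdef
  set K : ℕ → E → V := fun n => (bumpSeq E n).normed μ ⋆[lsmul ℝ ℝ, μ] h with hKdef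
  have hFs : ∀ n, ContDiff ℝ ∞ (F n) := ContDiff.bumpSeq_convolution hf
  have hKc : ∀ n, Continuous (K n) := fun n => (ContDiff.bumpSeq_convolution hh n).continuous
  have hK : ∀ n, Integrable (K n) μ := integrable_bumpSeq_convolution hh
  have hFK : ∀ n x, fderiv ℝ (F n) x e = K n x := fun n x =>
    H.fderiv_convolution hf (bumpSeq E n).contDiff_normed
      (bumpSeq E n).hasCompactSupport_normed x
  have hDG : Continuous (fderiv ℝ G) := hG.continuous_fderiv (by simp)
  have hDφ : Continuous fun x => fderiv ℝ φ x e :=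
    (hφ.continuous_fderiv (by simp)).clm_apply continuous_const
  have hDφc : HasCompactSupport fun x => fderiv ℝ φ x e := hφc.fderiv_apply ℝ e
  obtain ⟨A, hA⟩ := hG.continuous.bounded_above_of_compact_support hGc
  obtain ⟨B, hB⟩ := hDG.bounded_above_of_compact_support (hGc.fderiv ℝ)
  obtain ⟨P, hP⟩ := hφ.continuous.bounded_above_of_compact_support hφc
  have hB0 : 0 ≤ B := (norm_nonneg _).trans (hB 0)
  have hP0 : 0 ≤ P := (norm_nonneg _).trans (hP 0)
  have hGF : ∀ n x, fderiv ℝ (fun y => G (F n y)) x e = fderiv ℝ G (F n x) (K n x) := by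
    intro n x
    have h1 : HasFDerivAt (fun y => G (F n y)) ((fderiv ℝ G (F n x)).comp (fderiv ℝ (F n) x)) x :=
      (hG.differentiable (by simp) (F n x)).hasFDerivAt.comp x
        ((hFs n).differentiable (by simp) x).hasFDerivAt
    rw [h1.fderiv, comp_apply, hFK]
  have hibp : ∀ n, ∫ x, fderiv ℝ φ x e • G (F n x) ∂μ
      = - ∫ x, φ x • fderiv ℝ G (F n x) (K n x) ∂μ := by
    intro n
    have c1 : Continuous fun x => G (F n x) := hG.continuous.comp (hFs n).continuous
    have c2 : Continuous fun x => fderiv ℝ G (F n x) (K n x) :=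
      (hDG.comp (hFs n).continuous).clm_apply (hKc n)
    have := integral_smul_fderiv_eq_neg_fderiv_smul_of_integrable (μ := μ) (f := φ)
      (g := fun x => G (F n x)) (v := e)
      ((hDφ.smul c1).integrable_of_hasCompactSupport hDφc.smul_right)
      (by simp only [hGF]
          exact (hφ.continuous.smul c2).integrable_of_hasCompactSupport hφc.smul_right)
      ((hφ.continuous.smul c1).integrable_of_hasCompactSupport hφc.smul_right)
      (fun x _ => hφ.differentiable (by simp) x)
      (fun x _ => (hG.comp (hFs n)).differentiable (by simp) x)
    simp only [hGF] at this
    rw [this, neg_neg]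
  have haeF := ae_tendsto_bumpSeq_convolution hf
  have t1 : Tendsto (fun n => ∫ x, fderiv ℝ φ x e • G (F n x) ∂μ) atTop
      (𝓝 (∫ x, fderiv ℝ φ x e • G (f x) ∂μ)) := by
    refine tendsto_integral_of_dominated_convergence (fun x => ‖fderiv ℝ φ x e‖ * A)
      (fun n => (hDφ.smul (hG.continuous.comp (hFs n).continuous)).aestronglyMeasurable)
      ((hDφ.integrable_of_hasCompactSupport hDφc).norm.mul_const A) (fun n => ?_) ?_
    · refine Eventually.of_forall fun x => ?_
      rw [norm_smul]
      exact mul_le_mul_of_nonneg_left (hA _) (norm_nonneg _)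
    · filter_upwards [haeF] with x hx
      exact ((hG.continuous.tendsto _).comp hx).const_smul _
  have hmF : AEStronglyMeasurable (fun x => fderiv ℝ G (f x)) μ :=
    hDG.comp_aestronglyMeasurable hf.aestronglyMeasurable
  have hmFn : ∀ n, AEStronglyMeasurable (fun x => fderiv ℝ G (F n x)) μ := fun n =>
    (hDG.comp (hFs n).continuous).aestronglyMeasurable
  have hbd : ∀ (x : E) (y z : V), ‖φ x • fderiv ℝ G y z‖ ≤ P * B * ‖z‖ := fun x y z => by
    rw [norm_smul, mul_assoc]
    exact mul_le_mul (hP x) ((le_opNorm _ _).trans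
      (mul_le_mul_of_nonneg_right (hB _) (norm_nonneg _))) (norm_nonneg _) hP0
  have happ : ∀ {L : E → V →L[ℝ] ℝ} {k : E → V}, AEStronglyMeasurable L μ →
      AEStronglyMeasurable k μ → AEStronglyMeasurable (fun x => φ x • L x (k x)) μ :=
    fun hL hk => hφ.continuous.aestronglyMeasurable.smul
      (isBoundedBilinearMap_apply.continuous.comp_aestronglyMeasurable (hL.prodMk hk))
  -- The derivative is split as `DG(F n)(K n) = DG(F n)(h) + DG(F n)(K n - h)`: the first part
  -- converges by domination by `‖h‖`, the second vanishes because `DG` is bounded and `K n → h` in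
  -- `L¹`.
  have i2 : ∀ n, Integrable (fun x => φ x • fderiv ℝ G (F n x) (h x)) μ := fun n =>
    (hh.norm.const_mul (P * B)).mono' (happ (hmFn n) hh.aestronglyMeasurable)
      (Eventually.of_forall fun x => hbd x _ _)
  have i3 : ∀ n, Integrable (fun x => φ x • fderiv ℝ G (F n x) (K n x - h x)) μ := fun n =>
    (((hK n).sub hh).norm.const_mul (P * B)).mono'
      (happ (hmFn n) ((hK n).sub hh).aestronglyMeasurable)
      (Eventually.of_forall fun x => hbd x _ _)
  have t2 : Tendsto (fun n => ∫ x, φ x • fderiv ℝ G (F n x) (h x) ∂μ) atTop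
      (𝓝 (∫ x, φ x • fderiv ℝ G (f x) (h x) ∂μ)) := by
    refine tendsto_integral_of_dominated_convergence (fun x => P * B * ‖h x‖)
      (fun n => (i2 n).aestronglyMeasurable) (hh.norm.const_mul (P * B))
      (fun n => Eventually.of_forall fun x => hbd x _ _) ?_
    filter_upwards [haeF] with x hx
    have h1 : Tendsto (fun n => fderiv ℝ G (F n x)) atTop (𝓝 (fderiv ℝ G (f x))) :=
      (hDG.tendsto _).comp hx
    exact (((ContinuousLinearMap.apply ℝ ℝ (h x)).continuous.tendsto _).comp h1).const_smul _
  have t3 : Tendsto (fun n => ∫ x, φ x • fderiv ℝ G (F n x) (K n x - h x) ∂μ) atTop (𝓝 0) := by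
    refine squeeze_zero_norm (fun n => ?_)
      (by simpa using (tendsto_integral_norm_bumpSeq_convolution_sub hh).const_mul (P * B))
    refine (norm_integral_le_integral_norm _).trans ?_
    rw [← integral_const_mul]
    exact integral_mono (i3 n).norm (((hK n).sub hh).norm.const_mul (P * B)) fun x => hbd x _ _
  refine tendsto_nhds_unique t1 ?_
  simp only [hibp]
  refine Tendsto.neg ?_
  have := t3.add t2
  rw [zero_add] at this
  refine this.congr fun n => ?_
  rw [← integral_add (i3 n) (i2 n)]
  congr 1 with x
  simp only [map_sub, smul_eq_mul]
  ring

end Mollification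

/-! ### Leibniz rule for vanishing 2×2 minors. -/

section Products

open Filter Topology

theorem IsWeakDerivAlong.pi {E ι : Type*} [NormedAddCommGroup E] [NormedSpace ℝ E]
    [FiniteDimensional ℝ E] [MeasurableSpace E] [BorelSpace E] {μ : Measure E} [Fintype ι] {e : E}
    {f h : ι → E → ℝ} (H : ∀ k, IsWeakDerivAlong μ e (f k) (h k)) (hf : ∀ k, Integrable (f k) μ)
    (hh : ∀ k, Integrable (h k) μ) :
    IsWeakDerivAlong μ e (fun x k => f k x) (fun x k => h k x) := by
  intro φ hφ hφc
  have hDφ : Continuous fun x => fderiv ℝ φ x e :=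
    (hφ.continuous_fderiv (by simp)).clm_apply continuous_const
  have i1 : ∀ k, Integrable (fun x => (fderiv ℝ φ x e • fun k => f k x) k) μ := fun k =>
    (hf k).locallyIntegrable.integrable_smul_left_of_hasCompactSupport hDφ (hφc.fderiv_apply ℝ e)
  have i2 : ∀ k, Integrable (fun x => (φ x • fun k => h k x) k) μ := fun k =>
    (hh k).locallyIntegrable.integrable_smul_left_of_hasCompactSupport hφ.continuous hφc
  ext k
  rw [Pi.neg_apply, eval_integral i1, eval_integral i2]
  exact H k φ hφ hφc

/-- By the chain rule the expression is the weak derivative of `G ∘ f`, which is zero almost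
everywhere. -/
theorem IsWeakDerivAlong.fderiv_apply_ae_eq_zero {E V : Type*} [NormedAddCommGroup E]
    [NormedSpace ℝ E] [FiniteDimensional ℝ E] [MeasurableSpace E] [BorelSpace E] {μ : Measure E}
    [μ.IsAddHaarMeasure] [NormedAddCommGroup V] [NormedSpace ℝ V] [CompleteSpace V] {e : E}
    {f h : E → V} (H : IsWeakDerivAlong μ e f h) (hf : Integrable f μ) (hh : Integrable h μ)
    {G : V → ℝ} (hG : ContDiff ℝ ∞ G) (hGc : HasCompactSupport G)
    (h0 : ∀ᵐ x ∂μ, G (f x) = 0) : ∀ᵐ x ∂μ, fderiv ℝ G (f x) (h x) = 0 := by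
  have hDG : Continuous (fderiv ℝ G) := hG.continuous_fderiv (by simp)
  obtain ⟨B, hB⟩ := hDG.bounded_above_of_compact_support (hGc.fderiv ℝ)
  have hi : Integrable (fun x => fderiv ℝ G (f x) (h x)) μ :=
    (hh.norm.const_mul B).mono' (isBoundedBilinearMap_apply.continuous.comp_aestronglyMeasurable
      ((hDG.comp_aestronglyMeasurable hf.aestronglyMeasurable).prodMk hh.aestronglyMeasurable))
      (Eventually.of_forall fun x => (ContinuousLinearMap.le_opNorm _ _).trans
        (mul_le_mul_of_nonneg_right (hB _) (norm_nonneg _)))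
  refine ae_eq_zero_of_integral_contDiff_smul_eq_zero hi.locallyIntegrable fun φ hφ hφc => ?_
  have := H.comp hf hh hG hGc φ hφ hφc
  rw [← neg_eq_zero, ← this]
  refine integral_eq_zero_of_ae ?_
  filter_upwards [h0] with x hx
  simp [hx]

variable {m : ℕ} {Ω : Set (EuclideanSpace ℝ (Fin m))} {i : Fin m}

/-- Localization: multiplying by `ζ` turns data on `Ω` into integrable functions on the whole space,
where mollification is available. -/
theorem IsTestFunction.isWeakDerivAlong_mul {ζ u g : EuclideanSpace ℝ (Fin m) → ℝ}
    (hζ : IsTestFunction Ω ζ) (hu : IsWeakPartial Ω i u g) :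
    IsWeakDerivAlong volume (EuclideanSpace.single i 1) (fun x => u x * ζ x)
      (fun x => g x * ζ x + u x * fderiv ℝ ζ x (EuclideanSpace.single i 1)) := by
  intro φ hφ hφc
  set e : EuclideanSpace ℝ (Fin m) := EuclideanSpace.single i 1
  have hζφ := hζ.mul hφ
  have hd : ∀ x, fderiv ℝ (fun x => ζ x * φ x) x e = ζ x * fderiv ℝ φ x e + φ x * fderiv ℝ ζ x e :=
    fun x => by
      rw [fderiv_fun_mul (hζ.1.differentiable (by simp) x) (hφ.differentiable (by simp) x)]
      simp
  have h1 := (hζφ.fderiv_apply e).integrable_mul hu.1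
  have h2 := ((hζ.fderiv_apply e).mul hφ).integrable_mul hu.1
  have h3 := hζφ.integrable_mul hu.2.1
  calc ∫ x, fderiv ℝ φ x e • (u x * ζ x)
      = ∫ x, (u x * fderiv ℝ (fun x => ζ x * φ x) x e - u x * (fderiv ℝ ζ x e * φ x)) := by
        congr 1 with x
        rw [hd, smul_eq_mul]
        ring
    _ = - ((∫ x, g x * (ζ x * φ x)) + ∫ x, u x * (fderiv ℝ ζ x e * φ x)) := by
        rw [integral_sub h1 h2, hu.integral_eq hζφ]
        ring
    _ = _ := by
        rw [← integral_add h3 h2]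
        congr 2 with x
        rw [smul_eq_mul]
        ring

theorem ae_restrict_of_forall_test {P : EuclideanSpace ℝ (Fin m) → Prop} (hΩ : IsOpen Ω)
    (H : ∀ ζ, IsTestFunction Ω ζ → ∀ᵐ x, ζ x ≠ 0 → P x) : ∀ᵐ x ∂volume.restrict Ω, P x := by
  rw [ae_restrict_iff' hΩ.measurableSet, ae_iff]
  refine measure_null_of_locally_null _ fun x hx => ?_
  have hxΩ : x ∈ Ω := by
    by_contra h
    exact hx fun h' => absurd h' h
  obtain ⟨ζ, h1, h2, h3, -, h4⟩ := exists_contDiff_tsupport_subset (n := ⊤) (hΩ.mem_nhds hxΩ)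
  refine ⟨{y | ζ y ≠ 0} ∩ {y | ¬(y ∈ Ω → P y)}, inter_mem ?_ self_mem_nhdsWithin, ?_⟩
  · refine mem_nhdsWithin_of_mem_nhds (h3.continuous.continuousAt.eventually_ne ?_)
    simp [h4]
  · refine measure_mono_null ?_ (ae_iff.1 (H ζ ⟨h3, h2, h1⟩))
    rintro y ⟨hy, hy'⟩ h
    exact hy' fun _ => h hy

/-- Leibniz rule for `f 0 * f 3 - f 1 * f 2 = 0`, where the products of the functions with their
weak derivatives need not be locally integrable. -/
theorem IsWeakPartial.ae_leibniz_of_mul_sub_mul_eq_zero (hΩ : IsOpen Ω)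
    {f g : Fin 4 → EuclideanSpace ℝ (Fin m) → ℝ} (H : ∀ k, IsWeakPartial Ω i (f k) (g k))
    (h0 : ∀ᵐ x ∂volume.restrict Ω, f 0 x * f 3 x - f 1 x * f 2 x = 0) :
    ∀ᵐ x ∂volume.restrict Ω,
      g 0 x * f 3 x + f 0 x * g 3 x - g 1 x * f 2 x - f 1 x * g 2 x = 0 := by
  rw [ae_restrict_iff' hΩ.measurableSet] at h0
  refine ae_restrict_of_forall_test hΩ fun ζ hζ => ?_
  have hW := IsWeakDerivAlong.pi (fun k => hζ.isWeakDerivAlong_mul (H k))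
    (fun k => hζ.integrable_mul (H k).1) fun k =>
      (hζ.integrable_mul (H k).2.1).add ((hζ.fderiv_apply _).integrable_mul (H k).1)
  have hfi := Integrable.of_eval fun k => hζ.integrable_mul (H k).1
  have hhi := Integrable.of_eval fun k =>
      (hζ.integrable_mul (H k).2.1).add
        ((hζ.fderiv_apply (EuclideanSpace.single i 1)).integrable_mul (H k).1)
  let Q : (Fin 4 → ℝ) → ℝ := fun y => y 0 * y 3 - y 1 * y 2
  have hQ : ContDiff ℝ ∞ Q := by fun_prop
  have hDQ : ∀ y z, fderiv ℝ Q y z = z 0 * y 3 + y 0 * z 3 - z 1 * y 2 - y 1 * z 2 := by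
    intro y z
    have hp : ∀ k : Fin 4, HasFDerivAt (fun y : Fin 4 → ℝ => y k)
        (ContinuousLinearMap.proj (R := ℝ) (φ := fun _ : Fin 4 => ℝ) k) y :=
      fun k => (ContinuousLinearMap.proj (R := ℝ) (φ := fun _ : Fin 4 => ℝ) k).hasFDerivAt
    have hd : HasFDerivAt Q _ y := ((hp 0).mul (hp 3)).sub ((hp 1).mul (hp 2))
    rw [hd.fderiv]
    simp
    ring
  -- `Q` is not compactly supported, so it is cut off at radius about `R`. Integer radii keep the
  -- number of exceptional null sets countable.
  let χ : ℕ → ContDiffBump (0 : Fin 4 → ℝ) := fun R =>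
    ⟨R + 1, R + 2, by positivity, by linarith⟩
  have hR : ∀ R : ℕ, ∀ᵐ x, fderiv ℝ (fun y => Q y * χ R y) (fun k => f k x * ζ x)
      (fun k => g k x * ζ x + f k x * fderiv ℝ ζ x (EuclideanSpace.single i 1)) = 0 := by
    intro R
    refine hW.fderiv_apply_ae_eq_zero hfi hhi (hQ.mul (χ R).contDiff)
      (χ R).hasCompactSupport.mul_left ?_
    filter_upwards [h0] with x hx
    by_cases hxΩ : x ∈ Ω
    · have : Q (fun k => f k x * ζ x) = (f 0 x * f 3 x - f 1 x * f 2 x) * (ζ x * ζ x) := by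
        simp only [Q]
        ring
      rw [this, hx hxΩ, zero_mul, zero_mul]
    · simp [Q, hζ.eq_zero_of_notMem hxΩ]
  filter_upwards [ae_all_iff.2 hR, h0] with x hx hx0 hζx
  have hxΩ : x ∈ Ω := by
    by_contra h
    exact hζx (hζ.eq_zero_of_notMem h)
  -- For `R` beyond the norm of the value at `x`, the cutoff equals one near that value and `Q`
  -- itself is differentiated.
  obtain ⟨R, hxR⟩ := exists_nat_ge ‖fun k => f k x * ζ x‖
  have hloc : (fun y => Q y * χ R y) =ᶠ[𝓝 fun k => f k x * ζ x] Q := by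
    have hb : (fun k => f k x * ζ x) ∈ Metric.ball (0 : Fin 4 → ℝ) (χ R).rIn := by
      rw [mem_ball_zero_iff]
      exact hxR.trans_lt (lt_add_one _)
    filter_upwards [Metric.isOpen_ball.mem_nhds hb] with y hy
    rw [(χ R).one_of_mem_closedBall (Metric.ball_subset_closedBall hy), mul_one]
  have key := hx R
  rw [hloc.fderiv_eq, hDQ] at key
  -- `Q` is quadratic, so `key` is `ζ²` times the desired identity plus `2 ζ ∂ζ` times the vanishing
  -- minor.
  refine (mul_eq_zero.1 ?_).resolve_left (mul_ne_zero hζx hζx)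
  linear_combination key - 2 * ζ x * fderiv ℝ ζ x (EuclideanSpace.single i 1) * hx0 hxΩ

end Products

/-! ### The spaces `W^{k,1}` and `W₀^{k,1}`. -/

section Sobolev

open Filter Topology

variable {m : ℕ} {Ω : Set (EuclideanSpace ℝ (Fin m))} {u v w : EuclideanSpace ℝ (Fin m) → ℝ}
  {i : Fin m} {k : ℕ}

theorem MemSobolevOne.integrableOn (hu : MemSobolevOne Ω k u) : IntegrableOn u Ω := by
  cases k with
  | zero => exact hu
  | succ k => exact hu.1

theorem MemSobolevOne.isWeakPartial (hu : MemSobolevOne Ω (k + 1) u) (i : Fin m) :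
    IsWeakPartial Ω i u (weakPartial Ω i u) :=
  let ⟨_, hg, _⟩ := hu.2 i
  hg.isWeakPartial_weakPartial

theorem MemSobolevOne.integrableOn_weakPartial (hΩ : IsOpen Ω) (hu : MemSobolevOne Ω (k + 1) u)
    (i : Fin m) : IntegrableOn (weakPartial Ω i u) Ω :=
  let ⟨_, hg, hgk⟩ := hu.2 i
  hgk.integrableOn.congr (hg.weakPartial_ae_eq hΩ).symm

theorem MemSobolevOne.one_of_two (hu : MemSobolevOne Ω 2 u) : MemSobolevOne Ω 1 u :=
  ⟨hu.1, fun i => let ⟨g, hg, hg1⟩ := hu.2 i; ⟨g, hg, hg1.1⟩⟩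

/-- The weak gradient of a function in `W^{2,1}` is weakly differentiable. -/
theorem MemSobolevOne.exists_isWeakPartial_weakPartial (hΩ : IsOpen Ω) (hu : MemSobolevOne Ω 2 u)
    (i j : Fin m) : ∃ g, IsWeakPartial Ω j (weakPartial Ω i u) g := by
  obtain ⟨g, hg, hg1⟩ := hu.2 i
  obtain ⟨h, hh, -⟩ := hg1.2 j
  exact ⟨h, hh.congr (hg.weakPartial_ae_eq hΩ).symm .rfl⟩

theorem MemSobolevOne.add (hu : MemSobolevOne Ω 1 u) (hv : MemSobolevOne Ω 1 v) :
    MemSobolevOne Ω 1 (u + v) :=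
  ⟨hu.1.add hv.1, fun i => let ⟨g, hg, hg1⟩ := hu.2 i; let ⟨h, hh, hh1⟩ := hv.2 i
    ⟨g + h, hg.add hh, Integrable.add hg1 hh1⟩⟩

theorem MemSobolevOne.const_smul (hu : MemSobolevOne Ω 1 u) (c : ℝ) :
    MemSobolevOne Ω 1 (c • u) :=
  ⟨hu.1.smul c, fun i => let ⟨g, hg, hg1⟩ := hu.2 i
    ⟨c • g, hg.const_smul c, Integrable.smul c hg1⟩⟩

theorem MemSobolevOneZero.one_of_two (hu : MemSobolevOneZero Ω 2 u) : MemSobolevOneZero Ω 1 u := by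
  refine ⟨hu.1.one_of_two, fun ε hε => ?_⟩
  obtain ⟨φ, hφ, h⟩ := hu.2 ε hε
  refine ⟨φ, hφ, lt_of_le_of_lt ?_ h⟩
  simp only [sobolevOneNorm]
  gcongr
  exact le_self_add

theorem sobolevOneNorm_one_const_smul (hΩ : IsOpen Ω)
    (hu : ∀ i, IsWeakPartial Ω i u (weakPartial Ω i u)) (c : ℝ) :
    sobolevOneNorm Ω 1 (c • u) = ‖c‖ₑ * sobolevOneNorm Ω 1 u := by
  simp only [sobolevOneNorm, Pi.smul_apply, enorm_smul, mul_add, Finset.mul_sum]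
  rw [lintegral_const_mul' _ _ enorm_ne_top]
  congr 1
  refine Finset.sum_congr rfl fun i _ => ?_
  rw [← lintegral_const_mul' _ _ enorm_ne_top]
  refine lintegral_congr_ae ?_
  filter_upwards [((hu i).const_smul c).weakPartial_ae_eq hΩ] with x hx
  rw [hx, Pi.smul_apply, enorm_smul]

theorem MemSobolevOneZero.const_smul (hΩ : IsOpen Ω) (hu : MemSobolevOneZero Ω 1 u)
    (c : ℝ) : MemSobolevOneZero Ω 1 (c • u) := by
  refine ⟨hu.1.const_smul c, fun ε hε => ?_⟩
  obtain ⟨φ, hφ, h⟩ := hu.2 (ε / ‖c‖ₑ) (ENNReal.div_pos hε.ne' enorm_ne_top)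
  refine ⟨c • φ, hφ.const_mul c, ?_⟩
  rw [← smul_sub, sobolevOneNorm_one_const_smul hΩ fun i =>
    ((hu.1.isWeakPartial i).sub hφ.1.isWeakPartial).isWeakPartial_weakPartial]
  exact ENNReal.mul_lt_of_lt_div' h

/-- Integration by parts of a function in `W₀^{1,1}` against a function which need not vanish on
the boundary. -/
theorem MemSobolevOneZero.integral_mul_fderiv (hΩ : IsOpen Ω) (hw : MemSobolevOneZero Ω 1 w)
    (i : Fin m) {ψ : EuclideanSpace ℝ (Fin m) → ℝ} (hψ : ContDiff ℝ ∞ ψ)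
    (hψc : HasCompactSupport ψ) :
    ∫ x in Ω, (w x * fderiv ℝ ψ x (EuclideanSpace.single i 1) + weakPartial Ω i w x * ψ x) = 0 := by
  have hDψ : Continuous fun x => fderiv ℝ ψ x (EuclideanSpace.single i (1 : ℝ)) :=
    (hψ.continuous_fderiv (by simp)).clm_apply continuous_const
  obtain ⟨A, hA⟩ := hψ.continuous.bounded_above_of_compact_support hψc
  obtain ⟨B, hB⟩ := hDψ.bounded_above_of_compact_support (hψc.fderiv_apply ℝ _)
  set M := max A B
  -- For a test function `φ` in place of `w` the integral is zero, so it is bounded by `M` times the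
  -- `W^{1,1}` norm of `w - φ`.
  have key : ∀ ε : ℝ≥0∞, 0 < ε → ‖∫ x in Ω, (w x * fderiv ℝ ψ x (EuclideanSpace.single i 1)
      + weakPartial Ω i w x * ψ x)‖ₑ ≤ ENNReal.ofReal M * ε := by
    intro ε hε
    obtain ⟨φ, hφ, h⟩ := hw.2 ε hε
    have hf := (hw.1.isWeakPartial i).sub (hφ.1.isWeakPartial (Ω := Ω) (i := i))
    have e0 : ∫ x in Ω, (φ x * fderiv ℝ ψ x (EuclideanSpace.single i 1)
        + fderiv ℝ φ x (EuclideanSpace.single i 1) * ψ x) = 0 := by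
      have h1 := (hψ.isWeakPartial (Ω := Ω) (i := i)).2.2 φ hφ
      have i1 := hφ.integrable_mul (hψ.isWeakPartial (Ω := Ω) (i := i)).2.1
      have i2 := (hφ.fderiv_apply (EuclideanSpace.single i 1)).integrable_mul
        (hψ.isWeakPartial (Ω := Ω) (i := i)).1
      simp only [mul_comm (φ _), mul_comm (fderiv ℝ φ _ _)]
      rw [integral_add i1.integrableOn i2.integrableOn, h1, add_neg_cancel]
    have hDφ : Continuous fun x => fderiv ℝ φ x (EuclideanSpace.single i (1 : ℝ)) :=
      (hφ.fderiv_apply _).1.continuous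
    have iw : Integrable (fun x => w x * fderiv ℝ ψ x (EuclideanSpace.single i 1)
        + weakPartial Ω i w x * ψ x) (volume.restrict Ω) :=
      (hw.1.1.mul_bdd hDψ.aestronglyMeasurable (Eventually.of_forall hB)).add
        ((hw.1.integrableOn_weakPartial hΩ i).mul_bdd hψ.continuous.aestronglyMeasurable
          (Eventually.of_forall hA))
    have iφ : Integrable (fun x => φ x * fderiv ℝ ψ x (EuclideanSpace.single i 1)
        + fderiv ℝ φ x (EuclideanSpace.single i 1) * ψ x) (volume.restrict Ω) :=
      (((hφ.1.continuous.mul hDψ).integrable_of_hasCompactSupport hφ.2.1.mul_right).add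
        ((hDφ.mul hψ.continuous).integrable_of_hasCompactSupport hψc.mul_left)).restrict
    rw [← sub_zero (∫ x in Ω, _), ← e0, ← integral_sub iw iφ]
    refine (enorm_integral_le_lintegral_enorm _).trans ?_
    calc ∫⁻ x in Ω, ‖w x * fderiv ℝ ψ x (EuclideanSpace.single i 1) + weakPartial Ω i w x * ψ x
          - (φ x * fderiv ℝ ψ x (EuclideanSpace.single i 1)
            + fderiv ℝ φ x (EuclideanSpace.single i 1) * ψ x)‖ₑ
        ≤ ∫⁻ x in Ω, ENNReal.ofReal M * (‖(w - φ) x‖ₑ + ‖weakPartial Ω i (w - φ) x‖ₑ) := by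
          refine lintegral_mono_ae ?_
          filter_upwards [hf.weakPartial_ae_eq hΩ] with x hx
          have e : w x * fderiv ℝ ψ x (EuclideanSpace.single i 1) + weakPartial Ω i w x * ψ x
              - (φ x * fderiv ℝ ψ x (EuclideanSpace.single i 1)
                + fderiv ℝ φ x (EuclideanSpace.single i 1) * ψ x)
              = fderiv ℝ ψ x (EuclideanSpace.single i 1) * (w - φ) x
                + ψ x * weakPartial Ω i (w - φ) x := by
            rw [hx]
            simp only [Pi.sub_apply]
            ring
          rw [e, mul_add]
          refine (enorm_add_le _ _).trans ?_
          rw [enorm_mul, enorm_mul]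
          gcongr
          · rw [← ofReal_norm]
            exact ENNReal.ofReal_le_ofReal ((hB x).trans (le_max_right _ _))
          · rw [← ofReal_norm]
            exact ENNReal.ofReal_le_ofReal ((hA x).trans (le_max_left _ _))
      _ ≤ ENNReal.ofReal M * sobolevOneNorm Ω 1 (w - φ) := by
          rw [lintegral_const_mul' _ _ ENNReal.ofReal_ne_top, lintegral_add_left'
            hf.1.aestronglyMeasurable.enorm]
          simp only [sobolevOneNorm]
          gcongr
          exact Finset.single_le_sum (f := fun j => ∫⁻ x in Ω, ‖weakPartial Ω j (w - φ) x‖ₑ)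
            (fun _ _ => zero_le) (Finset.mem_univ i)
      _ ≤ _ := by gcongr
  rw [← enorm_eq_zero, ← nonpos_iff_eq_zero]
  have t : Tendsto (fun ε => ENNReal.ofReal M * ε) (𝓝[>] 0) (𝓝 (ENNReal.ofReal M * 0)) :=
    (ENNReal.Tendsto.const_mul tendsto_id (Or.inr ENNReal.ofReal_ne_top)).mono_left
      nhdsWithin_le_nhds
  rw [mul_zero] at t
  exact ge_of_tendsto t (eventually_mem_nhdsWithin.mono fun ε hε => key ε hε)

/-- A function in `W₀^{1,1}` of a bounded open set vanishes if one of its weak partial derivatives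
vanishes. -/
theorem MemSobolevOneZero.ae_eq_zero (hΩ : IsOpen Ω) (hb : Bornology.IsBounded Ω)
    (hw : MemSobolevOneZero Ω 1 w) (h0 : weakPartial Ω i w =ᵐ[volume.restrict Ω] 0) :
    w =ᵐ[volume.restrict Ω] 0 := by
  refine ae_restrict_eq_zero_of_forall_test hΩ hw.1.1.locallyIntegrableOn fun ψ hψ => ?_
  set e : EuclideanSpace ℝ (Fin m) := EuclideanSpace.single i 1 with he
  have hDψ : Continuous fun x => fderiv ℝ ψ x e := (hψ.fderiv_apply e).1.continuous
  obtain ⟨A, hA⟩ := hψ.1.continuous.bounded_above_of_compact_support hψ.2.1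
  obtain ⟨B, hB⟩ := hDψ.bounded_above_of_compact_support (hψ.2.1.fderiv_apply ℝ e)
  have hshift : ∀ t : ℝ, Continuous fun x : EuclideanSpace ℝ (Fin m) => x + t • e := fun t => by
    fun_prop
  have hd : ∀ x (t : ℝ), HasDerivAt (fun t : ℝ => ψ (x + t • e)) (fderiv ℝ ψ (x + t • e) e) t := by
    intro x t
    have h1 : HasDerivAt (fun t : ℝ => x + t • e) e t := by
      simpa using ((hasDerivAt_id t).smul_const e).const_add x
    exact (hψ.1.differentiable (by simp) _).hasFDerivAt.comp_hasDerivAt t h1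
  -- Translating `ψ` along `e` does not change `∫ w ψ`: its derivative in `t` is `-∫ (∂ᵢw) ψ(· + te)
  -- = 0`. Translates may leave `Ω`, which is where zero boundary values enter.
  have hz : ∀ t : ℝ, ∫ x in Ω, w x * fderiv ℝ ψ (x + t • e) e = 0 := by
    intro t
    have h1 : ContDiff ℝ ∞ fun x => ψ (x + t • e) := hψ.1.comp (contDiff_id.add contDiff_const)
    have h2 : HasCompactSupport fun x => ψ (x + t • e) :=
      hψ.2.1.comp_homeomorph (Homeomorph.addRight (t • e))
    rw [← hw.integral_mul_fderiv hΩ i h1 h2]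
    refine integral_congr_ae ?_
    filter_upwards [h0] with x hx
    rw [hx, fderiv_comp_add_right]
    simp [he]
  have hder : ∀ t : ℝ, HasDerivAt (fun t : ℝ => ∫ x in Ω, w x * ψ (x + t • e)) 0 t := by
    intro t
    rw [← hz t]
    refine (hasDerivAt_integral_of_dominated_loc_of_deriv_le (F := fun t x => w x * ψ (x + t • e))
      (F' := fun t x => w x * fderiv ℝ ψ (x + t • e) e) (bound := fun x => ‖w x‖ * B)
      univ_mem (Eventually.of_forall fun t => ?_) ?_ ?_ ?_ (hw.1.1.norm.mul_const B) ?_).2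
    · exact hw.1.1.aestronglyMeasurable.mul
        (hψ.1.continuous.comp (hshift t)).aestronglyMeasurable
    · exact hw.1.1.mul_bdd (hψ.1.continuous.comp (hshift t)).aestronglyMeasurable
        (Eventually.of_forall fun x => hA _)
    · exact hw.1.1.aestronglyMeasurable.mul (hDψ.comp (hshift t)).aestronglyMeasurable
    · refine Eventually.of_forall fun x s _ => ?_
      rw [norm_mul]
      exact mul_le_mul_of_nonneg_left (hB _) (norm_nonneg _)
    · exact Eventually.of_forall fun x s _ => (hd x s).const_mul (w x)
  have hconst := is_const_of_deriv_eq_zero (fun t => (hder t).differentiableAt)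
    fun t => (hder t).deriv
  obtain ⟨R, hR⟩ := hb.subset_ball 0
  have hR' : tsupport ψ ⊆ Metric.ball 0 R := hψ.2.2.trans hR
  -- Two points of the ball of radius `R` cannot differ by a vector of length `2|R|`, so this
  -- translate vanishes on `Ω`.
  have hend : ∫ x in Ω, w x * ψ (x + (2 * |R|) • e) = 0 := by
    refine setIntegral_eq_zero_of_forall_eq_zero fun x hx => ?_
    rw [image_eq_zero_of_notMem_tsupport (f := ψ), mul_zero]
    intro h
    have h1 := mem_ball_zero_iff.1 (hR hx)
    have h2 := mem_ball_zero_iff.1 (hR' h)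
    have h3 : ‖(2 * |R|) • e‖ = 2 * |R| := by
      rw [norm_smul, he, PiLp.norm_single]
      simp
    have h4 := norm_sub_le (x + (2 * |R|) • e) x
    rw [add_sub_cancel_left, h3] at h4
    linarith [le_abs_self R]
  have := hconst 0 (2 * |R|)
  simpa [hend] using this

end Sobolev

/-! ### Comparison of two minimizers. -/

section Minimizers

open Filter

variable {m : ℕ} {Ω : Set (EuclideanSpace ℝ (Fin m))}
  {F : EuclideanSpace ℝ (Fin m) → EuclideanSpace ℝ (Fin m)}
  {H u v : EuclideanSpace ℝ (Fin m) → ℝ}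

theorem MemSobolevOne.integrableOn_weakGrad (hΩ : IsOpen Ω) (hu : MemSobolevOne Ω 1 u) :
    IntegrableOn (weakGrad Ω u) Ω :=
  Integrable.of_eval_piLp fun i => hu.integrableOn_weakPartial hΩ i

theorem weakGrad_add_const_smul (hΩ : IsOpen Ω) (hu : MemSobolevOne Ω 1 u)
    (hv : MemSobolevOne Ω 1 v) (c : ℝ) :
    weakGrad Ω (u + c • v) =ᵐ[volume.restrict Ω] weakGrad Ω u + c • weakGrad Ω v := by
  have h : ∀ᵐ x ∂volume.restrict Ω, ∀ i,
      weakPartial Ω i (u + c • v) x = weakPartial Ω i u x + c * weakPartial Ω i v x :=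
    ae_all_iff.2 fun i =>
      ((hu.isWeakPartial i).add ((hv.isWeakPartial i).const_smul c)).weakPartial_ae_eq hΩ
  filter_upwards [h] with x hx
  ext i
  simp [weakGrad, hx i]

theorem MemSobolevOne.integrableOn_genPArea (hΩ : IsOpen Ω) (hF : IntegrableOn F Ω)
    (hH : MemLp H ⊤ (volume.restrict Ω)) (hu : MemSobolevOne Ω 1 u) :
    IntegrableOn (fun x => ‖weakGrad Ω u x + F x‖ + H x * u x) Ω :=
  ((hu.integrableOn_weakGrad hΩ).add hF).norm.add
    (Integrable.mul_of_top_right hu.1 hH)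

/-- The vector fields `∇u + F` and `∇v + F` of two minimizers point in the same direction. -/
theorem IsGenPAreaMinimizer.sameRay (hΩ : IsOpen Ω) (hF : IntegrableOn F Ω)
    (hH : MemLp H ⊤ (volume.restrict Ω)) (hu : IsGenPAreaMinimizer Ω F H u)
    (hv : IsGenPAreaMinimizer Ω F H v) (huv : MemSobolevOneZero Ω 1 (u - v)) :
    ∀ᵐ x ∂volume.restrict Ω, SameRay ℝ (weakGrad Ω u x + F x) (weakGrad Ω v x + F x) := by
  -- Both sides are `(u + v) / 2`, written as an admissible variation of `u` and of `v`.
  have e : u + (-1 / 2 : ℝ) • (u - v) = v + (1 / 2 : ℝ) • (u - v) := by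
    ext x
    simp only [Pi.add_apply, Pi.smul_apply, Pi.sub_apply, smul_eq_mul]
    ring
  set w := u + (-1 / 2 : ℝ) • (u - v) with hw
  have hw1 : MemSobolevOne Ω 1 w := hu.1.add (huv.1.const_smul _)
  have l1 : genPArea Ω F H u ≤ genPArea Ω F H w := hu.2 _ (huv.const_smul hΩ _)
  have l2 : genPArea Ω F H v ≤ genPArea Ω F H w := by
    rw [e]
    exact hv.2 _ (huv.const_smul hΩ _)
  have g1 := weakGrad_add_const_smul hΩ hu.1 huv.1 (-1 / 2)
  have g2 := weakGrad_add_const_smul hΩ hv.1 huv.1 (1 / 2)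
  rw [← e] at g2
  have iu := hu.1.integrableOn_genPArea hΩ hF hH
  have iv := hv.1.integrableOn_genPArea hΩ hF hH
  have iw := hw1.integrableOn_genPArea hΩ hF hH
  have hD : ∀ᵐ x ∂volume.restrict Ω, ‖weakGrad Ω u x + F x‖ + H x * u x
      + (‖weakGrad Ω v x + F x‖ + H x * v x) - 2 * (‖weakGrad Ω w x + F x‖ + H x * w x)
      = ‖weakGrad Ω u x + F x‖ + ‖weakGrad Ω v x + F x‖
        - ‖(weakGrad Ω u x + F x) + (weakGrad Ω v x + F x)‖ := by
    filter_upwards [g1, g2] with x h1 h2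
    have h3 : (weakGrad Ω u x + F x) + (weakGrad Ω v x + F x)
        = (2 : ℝ) • (weakGrad Ω w x + F x) := by
      have h4 : (2 : ℝ) • weakGrad Ω w x = weakGrad Ω u x + weakGrad Ω v x := by
        rw [two_smul]
        nth_rw 1 [h1]
        rw [h2]
        simp only [Pi.add_apply, Pi.smul_apply]
        module
      rw [smul_add, h4]
      module
    have h5 : w x = u x + -1 / 2 * (u x - v x) := rfl
    rw [h3, norm_smul, h5, Real.norm_ofNat]
    ring
  -- Minimality makes the integral nonpositive, while by `hD` the integrand is a triangle-inequality
  -- defect, hence nonnegative.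
  have hint : ∫ x in Ω, (‖weakGrad Ω u x + F x‖ + H x * u x
      + (‖weakGrad Ω v x + F x‖ + H x * v x) - 2 * (‖weakGrad Ω w x + F x‖ + H x * w x)) = 0 := by
    refine le_antisymm ?_ (integral_nonneg_of_ae ?_)
    · have e1 := integral_sub (iu.add iv) (iw.const_mul 2)
      simp only [Pi.add_apply] at e1
      rw [e1, integral_add iu iv, integral_const_mul]
      simp only [genPArea] at l1 l2
      linarith
    · filter_upwards [hD] with x hx
      rw [hx]
      exact sub_nonneg.2 (norm_add_le _ _)
  rw [integral_eq_zero_iff_of_nonneg_ae] at hint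
  · filter_upwards [hD, hint] with x h1 h2
    rw [sameRay_iff_norm_add]
    rw [h1, Pi.zero_apply] at h2
    linarith
  · filter_upwards [hD] with x hx
    rw [hx]
    exact sub_nonneg.2 (norm_add_le _ _)
  · exact (iu.add iv).sub (iw.const_mul 2)

theorem SameRay.mul_eq_mul {a b : EuclideanSpace ℝ (Fin m)} (h : SameRay ℝ a b) (I J : Fin m) :
    a I * b J = a J * b I := by
  rcases h with rfl | rfl | ⟨r, s, hr, hs, h⟩
  · simp
  · simp
  · have e : ∀ K, r * a K = s * b K := fun K => congrArg (fun z : EuclideanSpace ℝ (Fin m) => z K) h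
    refine mul_left_cancel₀ hr.ne' ?_
    linear_combination b J * e I - b I * e J

/-- If `η = dw` is parallel to the weakly differentiable 1-form `α`, then `η ∧ dα = 0`. -/
theorem wedgeOneTwo_weakExtDerivOne_ae_eq_zero (hΩ : IsOpen Ω)
    {w : EuclideanSpace ℝ (Fin m) → ℝ} {α η : Fin m → EuclideanSpace ℝ (Fin m) → ℝ}
    (hw : ∀ I, IsWeakPartial Ω I w (η I)) (hη : ∀ I J, ∃ g, IsWeakPartial Ω J (η I) g)
    (hα : ∀ I J, ∃ g, IsWeakPartial Ω J (α I) g)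
    (hp : ∀ᵐ x ∂volume.restrict Ω, ∀ I J, η I x * α J x - η J x * α I x = 0) :
    ∀ᵐ x ∂volume.restrict Ω, ∀ I J K,
      wedgeOneTwo (fun A => η A x) (fun A B => weakExtDerivOne Ω α A B x) I J K = 0 := by
  choose h hh using hη
  have hA : ∀ I J, IsWeakPartial Ω J (α I) (weakPartial Ω J (α I)) := fun I J =>
    let ⟨_, hg⟩ := hα I J
    hg.isWeakPartial_weakPartial
  have hsymm : ∀ᵐ x ∂volume.restrict Ω, ∀ I J, h I J x = h J I x :=
    ae_all_iff.2 fun I => ae_all_iff.2 fun J =>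
      IsWeakPartial.second_comm hΩ (hw J) (hw I) (hh I J) (hh J I)
  have hL : ∀ᵐ x ∂volume.restrict Ω, ∀ I J K,
      h I K x * α J x + η I x * weakPartial Ω K (α J) x
        - h J K x * α I x - η J x * weakPartial Ω K (α I) x = 0 := by
    refine ae_all_iff.2 fun I => ae_all_iff.2 fun J => ae_all_iff.2 fun K => ?_
    have := IsWeakPartial.ae_leibniz_of_mul_sub_mul_eq_zero (i := K) hΩ
      (f := ![η I, η J, α I, α J])
      (g := ![h I K, h J K, weakPartial Ω K (α I), weakPartial Ω K (α J)])
      (fun k => by fin_cases k <;> simp [hh, hA])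
      (by filter_upwards [hp] with x hx; exact hx I J)
    exact this
  filter_upwards [hsymm, hL] with x hs hx I J K
  simp only [wedgeOneTwo, weakExtDerivOne]
  -- The cyclic sum of the Leibniz identities is `d(η ∧ α) = dη ∧ α - η ∧ dα`, and symmetry of `h`
  -- is `dη = 0`.
  linear_combination -(hx I J K) - hx J K I - hx K I J + α J x * hs I K + α K x * hs J I
    + α I x * hs K J

/-- Parallelism gives `η_L (a ∧ b) = a_L (η ∧ b)` componentwise, with no division by `a`. -/
theorem eq_zero_of_wedgeOneTwo {a η : Fin m → ℝ} {b : Fin m → Fin m → ℝ}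
    (hp : ∀ I J, η I * a J - η J * a I = 0) (hη : ∀ I J K, wedgeOneTwo η b I J K = 0)
    {I J K : Fin m} (h : wedgeOneTwo a b I J K ≠ 0) (L : Fin m) : η L = 0 := by
  refine (mul_eq_zero.1 ?_).resolve_right h
  have := hη I J K
  simp only [wedgeOneTwo] at this ⊢
  linear_combination a L * this + b J K * hp L I + b K I * hp L J + b I J * hp L K

theorem ae_eq_of_thetaNonintegrable (hΩ : IsOpen Ω) (hb : Bornology.IsBounded Ω)
    (hΩ0 : Ω.Nonempty) (hFi : IntegrableOn F Ω)
    (hF : ∀ I, WeaklyDifferentiable Ω (fun x => F x I)) (hH : MemLp H ⊤ (volume.restrict Ω))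
    (hu : MemSobolevOne Ω 2 u) (hv : MemSobolevOne Ω 2 v) (hu_min : IsGenPAreaMinimizer Ω F H u)
    (hv_min : IsGenPAreaMinimizer Ω F H v) (huv : MemSobolevOneZero Ω 1 (u - v))
    (hΘ : ThetaNonintegrable Ω F u) : u =ᵐ[volume.restrict Ω] v := by
  have hray := hu_min.sameRay hΩ hFi hH hv_min huv
  set η : Fin m → EuclideanSpace ℝ (Fin m) → ℝ := fun I => weakPartial Ω I u - weakPartial Ω I v
  have hw : ∀ I, IsWeakPartial Ω I (u - v) (η I) := fun I =>
    (hu.isWeakPartial I).sub (hv.isWeakPartial I)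
  have hη : ∀ I J, ∃ g, IsWeakPartial Ω J (η I) g := fun I J =>
    let ⟨_, hg⟩ := hu.exists_isWeakPartial_weakPartial hΩ I J
    let ⟨_, hh⟩ := hv.exists_isWeakPartial_weakPartial hΩ I J
    ⟨_, hg.sub hh⟩
  have hα : ∀ I J, ∃ g, IsWeakPartial Ω J (thetaForm Ω F u I) g := fun I J =>
    let ⟨_, hg⟩ := hu.exists_isWeakPartial_weakPartial hΩ I J
    let ⟨_, hh⟩ := (hF I).2 J
    ⟨_, hg.add hh⟩
  have hp : ∀ᵐ x ∂volume.restrict Ω, ∀ I J,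
      η I x * thetaForm Ω F u J x - η J x * thetaForm Ω F u I x = 0 := by
    filter_upwards [hray] with x hx I J
    have := hx.mul_eq_mul I J
    simp only [weakGrad, PiLp.add_apply] at this
    simp only [η, thetaForm, Pi.sub_apply]
    linear_combination this
  have hη0 : ∀ᵐ x ∂volume.restrict Ω, ∀ L, η L x = 0 := by
    filter_upwards [hp, wedgeOneTwo_weakExtDerivOne_ae_eq_zero hΩ hw hη hα hp, hΘ]
      with x h1 h2 ⟨I, J, K, h3⟩
    exact eq_zero_of_wedgeOneTwo h1 h2 h3
  -- Positive measure of `Ω` yields a point where `Θ_u ∧ dΘ_u ≠ 0`, and with it a coordinate index;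
  -- this excludes `m = 0`.
  have : NeZero (volume.restrict Ω) :=
    ⟨fun h => (hΩ.measure_pos volume hΩ0).ne' (Measure.restrict_eq_zero.1 h)⟩
  obtain ⟨_, I, -⟩ := hΘ.exists
  have h0 : weakPartial Ω I (u - v) =ᵐ[volume.restrict Ω] 0 := by
    filter_upwards [(hw I).weakPartial_ae_eq hΩ, hη0] with x h1 h2
    rw [h1, h2, Pi.zero_apply]
  filter_upwards [huv.ae_eq_zero hΩ hb h0] with x hx
  simpa [sub_eq_zero] using hx

end Minimizers

theorem mainTheorem10 {m : ℕ} (Ω : Set (EuclideanSpace ℝ (Fin m)))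
    (hΩ_open : IsOpen Ω) (hΩ_conn : IsConnected Ω) (hΩ_bdd : Bornology.IsBounded Ω)
    (F : EuclideanSpace ℝ (Fin m) → EuclideanSpace ℝ (Fin m))
    (hF_int : IntegrableOn F Ω)
    (hF : ∀ I, WeaklyDifferentiable Ω (fun x => F x I))
    (H : EuclideanSpace ℝ (Fin m) → ℝ) (hH : MemLp H ⊤ (volume.restrict Ω))
    (u v : EuclideanSpace ℝ (Fin m) → ℝ)
    (hu : MemSobolevOne Ω 2 u) (hv : MemSobolevOne Ω 2 v)
    (hu_min : IsGenPAreaMinimizer Ω F H u) (hv_min : IsGenPAreaMinimizer Ω F H v)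
    (huv : MemSobolevOneZero Ω 2 (u - v))
    (C : ℝ) (hC : 0 < C)
    (hu_C : ∀ᵐ x ∂(volume.restrict Ω), C ≤ ‖weakGrad Ω u x + F x‖)
    (hv_C : ∀ᵐ x ∂(volume.restrict Ω), C ≤ ‖weakGrad Ω v x + F x‖)
    (hΘ : ThetaNonintegrable Ω F u ∨ ThetaNonintegrable Ω F v) :
    u =ᵐ[volume.restrict Ω] v := by
  rcases hΘ with hΘ | hΘ
  · exact ae_eq_of_thetaNonintegrable hΩ_open hΩ_bdd hΩ_conn.nonempty hF_int hF hH hu hv hu_min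
      hv_min huv.one_of_two hΘ
  · refine (ae_eq_of_thetaNonintegrable hΩ_open hΩ_bdd hΩ_conn.nonempty hF_int hF hH hv hu hv_min
      hu_min ?_ hΘ).symm
    simpa using huv.one_of_two.const_smul hΩ_open (-1)
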